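/- Let $G$ be a finite directed graph with $n\ge 1$ nodes, let $I(v)$ be the set of in-neighbours of $v$, and let $c\in(0,1)$. The SimRank scores $s(u,v)$ are the unique solution of $s(u,u)=1$ and $s(u,v)=\frac{c}{|I(u)||I(v)|}\sum_{a\in I(u),\,b\in I(v)}s(a,b)$ for $u\neq v$ (read as $0$ if $I(u)$ or $I(v)$ is empty). A $\sqrt c$-walk from $u$ starts at $u$ (its $0$-th step); at each step it stops with probability $1-\sqrt c$, and otherwise it moves to a uniformly random in-neighbour of the current node (it stops if there is none). Two walks meet if for some $\ell\ge 0$ their $\ell$-th steps both exist and are identical. *Algorithm 1* (input: a node $v_k$ and $\varepsilon_d,\delta_d>0$). If $I(v_k)=\emptyset$, return $\tilde d_k=1$. Otherwise let $n_r=\left\lceil\frac{2c^2+c\,\varepsilon_d}{\varepsilon_d^2}\log\frac{2}{\delta_d}\right\rceil$ and repeat the following $n_r$ times with fresh randomness: select two nodes of $I(v_k)$ independently and uniformly at random; if they are different, generate independent $\sqrt c$-walks from them. Let $cnt$ be the number of rounds in which two walks are generated and meet. Return $\tilde d_k=1-\frac{c}{|I(v_k)|}-c\,\frac{cnt}{n_r}$.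 *Algorithm 2* (input: $G$ and a threshold $\theta\in(0,1)$). For each node $v_k$, start with the single step-$0$ entry $\tilde h^{(0)}(v_k,v_k)=1$. For $\ell=0,1,2,\dots$, remove every step-$\ell$ entry $\tilde h^{(\ell)}(v_x,v_k)\le\theta$, and for every remaining one add $\sqrt c\,\tilde h^{(\ell)}(v_x,v_k)/|I(v_i)|$ to the entry $\tilde h^{(\ell+1)}(v_i,v_k)$ (which is created if it is absent) for each out-neighbour $v_i$ of $v_x$; stop when there is no entry at step $\ell+1$. The set $H(v_i)$ consists of all the entries $\tilde h^{(\ell)}(v_i,v_k)$ that remain, over all $\ell$ and $k$. *Algorithm 3* (single-pair query) returns $\tilde s(v_i,v_j)=\sum\tilde h^{(\ell)}(v_i,v_k)\,\tilde d_k\,\tilde h^{(\ell)}(v_j,v_k)$, the sum being over all $(\ell,k)$ with $\tilde h^{(\ell)}(v_i,v_k)\in H(v_i)$ and $\tilde h^{(\ell)}(v_j,v_k)\in H(v_j)$. **Theorem.** Suppose that each $\tilde d_k$ is derived by Algorithm 1 with input $\varepsilon_d$ and $\delta_d$, and the sets $H(v_k)$ are constructed by Algorithm 2 with input $\theta\in(0,1)$.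 If $\delta_d\le\delta/n$ and $$\frac{\varepsilon_d}{1-c}+\frac{2\sqrt c}{(1-\sqrt c)(1-c)}\,\theta\le\varepsilon,$$ then with probability at least $1-\delta$ we have $|\tilde s(v_i,v_j)-s(v_i,v_j)|\le\varepsilon$ for all nodes $v_i,v_j$ simultaneously. -/

import Mathlib

open scoped ENNReal

noncomputable section

namespace Sling

/-- The set `I(v)` of in-neighbours of a node `v` of a directed graph. -/
def inNbrs {V : Type*} [Fintype V] (G : Digraph V) [DecidableRel G.Adj] (v : V) : Finset V :=
  Finset.univ.filter fun u => G.Adj u v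

section SimRank

variable {V : Type*} [Fintype V] [DecidableEq V] (G : Digraph V) [DecidableRel G.Adj] (c : ℝ)

/-- The right-hand side of the defining equation of SimRank. If `I(u)` or `I(v)` is empty and
`u ≠ v`, the sum is empty and the value is `0`. -/
def simRankRHS (s : V → V → ℝ) (u v : V) : ℝ :=
  if u = v then 1
  else c / ((inNbrs G u).card * (inNbrs G v).card) * ∑ a ∈ inNbrs G u, ∑ b ∈ inNbrs G v, s a b

variable {c}

/-- The defining equation of SimRank has exactly one solution. -/
theorem existsUnique_simRank (hc : c ∈ Set.Ioo (0 : ℝ) 1) :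
    ∃! s : V → V → ℝ, ∀ u v, s u v = simRankRHS G c s u v := by
  obtain ⟨h0, h1⟩ := hc
  have key : ContractingWith (⟨c, h0.le⟩ : NNReal) (simRankRHS G c) := by
    refine ⟨by exact_mod_cast h1, LipschitzWith.of_dist_le_mul fun s t => ?_⟩
    have hnn : 0 ≤ c * dist s t := mul_nonneg h0.le dist_nonneg
    refine (dist_pi_le_iff hnn).2 fun u => (dist_pi_le_iff hnn).2 fun v => ?_
    unfold simRankRHS
    split_ifs with h
    · simpa using hnn
    · have hst : ∀ a b, |s a b - t a b| ≤ dist s t := fun a b => by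
        rw [← Real.dist_eq]
        exact (dist_le_pi_dist (s a) (t a) b).trans (dist_le_pi_dist s t a)
      rw [Real.dist_eq, ← mul_sub, abs_mul, ← Finset.sum_sub_distrib]
      have hsum : |∑ a ∈ inNbrs G u, ((∑ b ∈ inNbrs G v, s a b) - ∑ b ∈ inNbrs G v, t a b)|
          ≤ (inNbrs G u).card * ((inNbrs G v).card * dist s t) := by
        refine (Finset.abs_sum_le_sum_abs _ _).trans ?_
        rw [← nsmul_eq_mul]
        refine Finset.sum_le_card_nsmul _ _ _ fun a _ => ?_
        rw [← Finset.sum_sub_distrib]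
        refine (Finset.abs_sum_le_sum_abs _ _).trans ?_
        rw [← nsmul_eq_mul]
        exact Finset.sum_le_card_nsmul _ _ _ fun b _ => hst a b
      set p : ℝ := ((inNbrs G u).card : ℝ)
      set q : ℝ := ((inNbrs G v).card : ℝ)
      have hp : 0 ≤ p := Nat.cast_nonneg _
      have hq : 0 ≤ q := Nat.cast_nonneg _
      have hpq : 0 ≤ c / (p * q) := by positivity
      rw [abs_of_nonneg hpq]
      refine (mul_le_mul_of_nonneg_left hsum hpq).trans ?_
      change _ ≤ c * dist s t
      by_cases hz : p * q = 0
      · rw [hz, div_zero, zero_mul]; exact hnn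
      · rw [← mul_assoc p q, ← mul_assoc, div_mul_cancel₀ _ hz]
  refine ⟨ContractingWith.fixedPoint _ key, fun u v => ?_, fun t ht => ?_⟩
  · exact (congrFun (congrFun key.fixedPoint_isFixedPt u) v).symm
  · exact key.fixedPoint_unique (funext fun u => funext fun v => (ht u v).symm)

/-- The SimRank score `s(u, v)` with decay factor `c`. -/
def simRank (hc : c ∈ Set.Ioo (0 : ℝ) 1) : V → V → ℝ :=
  (existsUnique_simRank G hc).choose

theorem simRank_eq (hc : c ∈ Set.Ioo (0 : ℝ) 1) (u v : V) :
    simRank G hc u v =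
      if u = v then 1
      else c / ((inNbrs G u).card * (inNbrs G v).card) *
        ∑ a ∈ inNbrs G u, ∑ b ∈ inNbrs G v, simRank G hc a b :=
  (existsUnique_simRank G hc).choose_spec.1 u v

end SimRank

section Walk

variable {V : Type*} [Fintype V] [DecidableEq V] (G : Digraph V) [DecidableRel G.Adj] (c : ℝ)

/-- The probability that a `√c`-walk that is at `u` stops there: `1 - √c`, or `1` if `u` has no
in-neighbour to move to. -/
def stopProb (u : V) : ℝ≥0∞ :=
  if (inNbrs G u).Nonempty then ENNReal.ofReal (1 - √c) else 1

/-- The probability that a `√c`-walk moves from `u` to `y` in its next step: with probability `√c`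
it goes on, and then `y` is uniform in `I(u)`. -/
def moveProb (u y : V) : ℝ≥0∞ :=
  if y ∈ inNbrs G u then ENNReal.ofReal (√c / (inNbrs G u).card) else 0

/-- The probability that a `√c`-walk from `u` visits, after its start `u`, exactly the nodes in the
given list, in this order, and then stops. -/
def walkWeight : V → List V → ℝ≥0∞
  | u, [] => stopProb G c u
  | u, y :: l => moveProb G c u y * walkWeight y l

variable {c}

theorem tsum_list_eq {α : Type*} (f : List α → ℝ≥0∞) :
    ∑' l, f l = f [] + ∑' a, ∑' l, f (a :: l) := by
  let e : Unit ⊕ (α × List α) ≃ List α :=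
    { toFun := Sum.elim (fun _ => []) fun p => p.1 :: p.2
      invFun := fun l => match l with
        | [] => Sum.inl ()
        | a :: l => Sum.inr (a, l)
      left_inv := by rintro (_ | _) <;> rfl
      right_inv := by rintro (_ | _) <;> rfl }
  rw [← e.tsum_eq f, Summable.tsum_sum ENNReal.summable ENNReal.summable,
    ← ENNReal.tsum_prod]
  simp [e]

theorem tsum_moveProb_mul (u : V) (r : ℝ≥0∞) :
    (∑' y, moveProb G c u y * r) =
      if (inNbrs G u).Nonempty then ENNReal.ofReal √c * r else 0 := by
  rw [ENNReal.tsum_mul_right, tsum_fintype]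
  unfold moveProb
  rw [Finset.sum_ite_mem, Finset.univ_inter, Finset.sum_const, nsmul_eq_mul]
  split_ifs with h
  · have hpos : (0 : ℝ) < (inNbrs G u).card := by exact_mod_cast h.card_pos
    rw [← ENNReal.ofReal_natCast, ← ENNReal.ofReal_mul hpos.le, mul_div_cancel₀ _ hpos.ne']
  · rw [Finset.not_nonempty_iff_eq_empty] at h
    simp [h]

theorem tsum_walkWeight (hc : c ∈ Set.Ioo (0 : ℝ) 1) (u : V) :
    ∑' l, walkWeight G c u l = 1 := by
  have hs1 : √c < 1 := by
    rw [Real.sqrt_lt' one_pos]; simpa using hc.2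
  have hs0 : 0 ≤ √c := Real.sqrt_nonneg c
  have hone : ENNReal.ofReal (1 - √c) + ENNReal.ofReal √c = 1 := by
    rw [← ENNReal.ofReal_add (by linarith) hs0]; simp
  let T : ℕ → V → ℝ≥0∞ := fun n u => ∑' l, if l.length < n then walkWeight G c u l else 0
  have hT0 : ∀ u, T 0 u = 0 := fun u => by simp [T]
  have hT : ∀ n u, T (n + 1) u = stopProb G c u + ∑' y, moveProb G c u y * T n y := by
    intro n u
    simp only [T]
    rw [tsum_list_eq]
    simp only [List.length_nil, Nat.zero_lt_succ, if_true, walkWeight, List.length_cons,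
      Nat.add_lt_add_iff_right, ← ENNReal.tsum_mul_left, mul_ite, mul_zero]
  have hle : ∀ n u, T n u ≤ 1 := by
    intro n
    induction n with
    | zero => intro u; simp [hT0]
    | succ n ih =>
      intro u
      rw [hT]
      have h1 : (∑' y, moveProb G c u y * T n y) ≤ ∑' y, moveProb G c u y * 1 :=
        ENNReal.tsum_le_tsum fun y => mul_le_mul_right (ih y) _
      rw [tsum_moveProb_mul G] at h1
      refine (add_le_add_right h1 _).trans ?_
      unfold stopProb
      split_ifs with h
      · rw [mul_one, hone]
      · simp
  have hge : ∀ n u, 1 ≤ T n u + ENNReal.ofReal √c ^ n := by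
    intro n
    induction n with
    | zero => intro u; simp
    | succ n ih =>
      intro u
      rw [hT]
      by_cases h : (inNbrs G u).Nonempty
      · have h1 : (∑' y, moveProb G c u y * 1) ≤
            ∑' y, moveProb G c u y * (T n y + ENNReal.ofReal √c ^ n) :=
          ENNReal.tsum_le_tsum fun y => mul_le_mul_right (ih y) _
        simp only [mul_add] at h1
        rw [ENNReal.tsum_add, tsum_moveProb_mul G, tsum_moveProb_mul G, if_pos h, if_pos h,
          mul_one, ← pow_succ'] at h1
        rw [add_assoc]
        refine le_trans ?_ (add_le_add_right h1 _)
        rw [stopProb, if_pos h, hone]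
      · rw [stopProb, if_neg h, add_assoc]
        exact le_self_add
  apply le_antisymm
  · rw [ENNReal.tsum_eq_iSup_sum]
    refine iSup_le fun F => ?_
    refine le_trans ?_ (hle (F.sup List.length + 1) u)
    refine le_trans (Finset.sum_le_sum fun l hl => ?_) (ENNReal.sum_le_tsum F)
    have : l.length < F.sup List.length + 1 := Nat.lt_succ_of_le (Finset.le_sup hl)
    simp [this]
  · have hlim : Filter.Tendsto (fun n : ℕ => (∑' l, walkWeight G c u l) + ENNReal.ofReal √c ^ n)
        Filter.atTop (nhds ((∑' l, walkWeight G c u l) + 0)) :=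
      tendsto_const_nhds.add (ENNReal.tendsto_pow_atTop_nhds_zero_of_lt_one (by simpa using hs1))
    rw [add_zero] at hlim
    refine ge_of_tendsto' hlim fun n => (hge n u).trans (add_le_add_left ?_ _)
    exact ENNReal.tsum_le_tsum fun l => by split_ifs <;> simp

/-- The law of a `√c`-walk from `u`: the list of the nodes at its steps `0, 1, 2, …`, up to the
step at which it stops (it stops after finitely many steps with probability one). -/
def sqrtCWalk (hc : c ∈ Set.Ioo (0 : ℝ) 1) (u : V) : PMF (List V) :=
  PMF.map (fun l => u :: l)
    ⟨walkWeight G c u, tsum_walkWeight G hc u ▸ ENNReal.summable.hasSum⟩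

/-- Two walks meet if for some `ℓ` their `ℓ`-th steps exist and are identical. -/
def Meet (W W' : List V) : Prop :=
  ∃ (ℓ : ℕ) (w : V), W[ℓ]? = some w ∧ W'[ℓ]? = some w

end Walk

section CorrectionFactor

variable {V : Type*} [Fintype V] [DecidableEq V] (G : Digraph V) [DecidableRel G.Adj] {c : ℝ}

/-- The number `n_r` of samples (a whole number: the bound is rounded up). -/
def numSamples (c εd δd : ℝ) : ℕ :=
  ⌈(2 * c ^ 2 + c * εd) / εd ^ 2 * Real.log (2 / δd)⌉₊

open Classical in
/-- One round of the sampling loop, for a node with the non-empty set `S` of in-neighbours: select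
two nodes of `S` independently and uniformly; if they differ, generate a `√c`-walk from each,
independently. The value is the amount by which `cnt` increases. -/
def sampleRound (hc : c ∈ Set.Ioo (0 : ℝ) 1) (S : Finset V) (hS : S.Nonempty) : PMF ℕ :=
  (PMF.uniformOfFinset S hS).bind fun vi =>
  (PMF.uniformOfFinset S hS).bind fun vj =>
    if vi ≠ vj then
      (sqrtCWalk G hc vi).bind fun W =>
      (sqrtCWalk G hc vj).bind fun W' =>
        if Meet W W' then PMF.pure 1 else PMF.pure 0
    else PMF.pure 0

/-- The law of the counter `cnt` after a number of rounds, each with fresh randomness. -/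
def sampleCount (hc : c ∈ Set.Ioo (0 : ℝ) 1) (S : Finset V) (hS : S.Nonempty) : ℕ → PMF ℕ
  | 0 => PMF.pure 0
  | x + 1 =>
    (sampleCount hc S hS x).bind fun cnt =>
    (sampleRound G hc S hS).bind fun b => PMF.pure (cnt + b)

/-- The law of the output `d̃_k` of the sampling method for estimating the correction factor of the
node `k`, with error bound `εd` and failure probability `δd`. If `k` has no in-neighbour, nothing
can be sampled (two walks from `k` stop at once) and the output is `1`. -/
def estimateCorrection (hc : c ∈ Set.Ioo (0 : ℝ) 1) (εd δd : ℝ) (k : V) : PMF ℝ :=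
  if h : (inNbrs G k).Nonempty then
    (sampleCount G hc (inNbrs G k) h (numSamples c εd δd)).map fun cnt =>
      1 - c / (inNbrs G k).card - c * ((cnt : ℝ) / numSamples c εd δd)
  else PMF.pure 1

end CorrectionFactor

section HittingProbabilities

variable {V : Type*} [Fintype V] [DecidableEq V] (G : Digraph V) [DecidableRel G.Adj] (c θ : ℝ)

/-- Remove the entries that are at most `θ` (an absent entry is represented by `0`). -/
def prune (t : V → ℝ) (x : V) : ℝ := if t x ≤ θ then 0 else t x

/-- The entries at the next step: every entry at a node `x` adds `√c / |I(i)|` times its value to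
the entry at each out-neighbour `i` of `x`. -/
def push (t : V → ℝ) (i : V) : ℝ := ∑ x ∈ inNbrs G i, √c * (t x / (inNbrs G i).card)

/-- The entries `h̃^(ℓ)(·, k)` that the local update method inserts into `R_k` at step `ℓ`, as they
are when step `ℓ` starts to be processed. (Once a step has no entry, no later step has one.) -/
def backwardTable (k : V) : ℕ → V → ℝ
  | 0 => fun x => if x = k then 1 else 0
  | ℓ + 1 => push G c (prune θ (backwardTable k ℓ))

variable {c θ}

theorem backwardTable_le (k : V) (ℓ : ℕ) (x : V) :
    backwardTable G c θ k ℓ x ≤ √c ^ ℓ := by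
  induction ℓ generalizing x with
  | zero => simp only [backwardTable, pow_zero]; split_ifs <;> norm_num
  | succ ℓ ih =>
    have hs0 : 0 ≤ √c := Real.sqrt_nonneg c
    have hpr : ∀ y, prune θ (backwardTable G c θ k ℓ) y ≤ √c ^ ℓ := fun y => by
      unfold prune
      split_ifs
      · positivity
      · exact ih y
    simp only [backwardTable, push]
    rcases (inNbrs G x).eq_empty_or_nonempty with h | h
    · rw [h, Finset.sum_empty]; positivity
    · have hpos : (0 : ℝ) < (inNbrs G x).card := by exact_mod_cast h.card_pos
      refine (Finset.sum_le_card_nsmul _ _ (√c * (√c ^ ℓ / (inNbrs G x).card)) fun y _ => ?_).trans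
        (le_of_eq ?_)
      · have := hpr y
        gcongr
      · rw [nsmul_eq_mul, pow_succ]
        field_simp

theorem finite_retained (hc : c ∈ Set.Ioo (0 : ℝ) 1) (hθ : 0 < θ) (i : V) :
    (Function.support fun p : ℕ × V => prune θ (backwardTable G c θ p.2 p.1) i).Finite := by
  have hs1 : √c < 1 := by
    rw [Real.sqrt_lt' one_pos]; simpa using hc.2
  obtain ⟨N, hN⟩ := exists_pow_lt_of_lt_one hθ hs1
  refine ((Finset.range N ×ˢ (Finset.univ : Finset V)).finite_toSet).subset ?_
  rintro ⟨ℓ, k⟩ hp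
  simp only [Function.mem_support, prune, ne_eq, ite_eq_left_iff, not_le, not_forall] at hp
  obtain ⟨hp, -⟩ := hp
  simp only [Finset.coe_product, Finset.coe_range, Finset.coe_univ, Set.mem_prod, Set.mem_Iio,
    Set.mem_univ, and_true]
  by_contra hcon
  have h1 := backwardTable_le G (c := c) (θ := θ) k ℓ i
  have h2 : √c ^ ℓ ≤ √c ^ N :=
    pow_le_pow_of_le_one (Real.sqrt_nonneg c) hs1.le (not_lt.1 hcon)
  linarith

/-- The set `H(i)` of approximate hitting probabilities from `i` built with threshold `θ`: a finite
table that holds `h̃^(ℓ)(i, k)` under the key `(ℓ, k)`, for all entries that survive the pruning. Its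
support is the set of the keys that are present. -/
def hpIndex (hc : c ∈ Set.Ioo (0 : ℝ) 1) (hθ : 0 < θ) (i : V) : ℕ × V →₀ ℝ :=
  Finsupp.ofSupportFinite (fun p => prune θ (backwardTable G c θ p.2 p.1) i)
    (finite_retained G hc hθ i)

end HittingProbabilities

/-- The single-pair query: from the correction factors `d` and the tables `Hi`, `Hj` of the two
query nodes, sum over the entries of `Hi` whose key is also present in `Hj`. -/
def singlePairQuery {V : Type*} [DecidableEq V] (d : V → ℝ) (Hi Hj : ℕ × V →₀ ℝ) : ℝ :=
  ∑ p ∈ Hi.support, if p ∈ Hj.support then Hi p * d p.2 * Hj p else 0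

end Sling

end

/-! Let `hitProb` be the probability h^ℓ(i,k) that a √c-walk from i is at k at step ℓ, and
`correction` the probability d_k that two walks from k do not meet again. Then s(i,j) = ∑_ℓ ∑_k
h^ℓ(i,k) d_k h^ℓ(j,k), and the algorithm perturbs this series in two ways. Pruning lowers each h^ℓ
by at most θ(1 + √c + … + √c^(ℓ-1)) (`hitProb_sub_prune_le`). As ∑_k h^ℓ(i,k) ≤ √c^ℓ, replacing d_k
by d̃_k with error at most εd costs εd·c^ℓ at step ℓ, and pruning costs 2θ(√c^ℓ - c^ℓ)/(1 - √c)
(`abs_step_sub_le`). Summed over ℓ, this is the bound in the hypothesis, with no factor n. It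
remains to show that all |d̃_k - d_k| ≤ εd with probability at least 1 - δ. By uniqueness SimRank is
the meeting probability (`simRank_eq_meetProb`), so d_k is an affine function of the success
probability of one sampling round (`correction_eq`). A Chernoff bound for each node and a union
bound over the nodes finish the proof. -/

namespace Sling

open Finset

/-! ### The one-step operator `push`. -/

section Push

variable {V : Type*} [Fintype V] (G : Digraph V) [DecidableRel G.Adj] (c : ℝ)

theorem push_sub (t t' : V → ℝ) (i : V) :
    push G c t i - push G c t' i = push G c (fun x => t x - t' x) i := by
  simp only [push, ← Finset.sum_sub_distrib]
  exact Finset.sum_congr rfl fun x _ => by ring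

theorem push_sum {ι : Type*} (s : Finset ι) (t : ι → V → ℝ) (i : V) :
    push G c (fun x => ∑ k ∈ s, t k x) i = ∑ k ∈ s, push G c (t k) i := by
  simp only [push]
  rw [Finset.sum_comm]
  exact Finset.sum_congr rfl fun x _ => by rw [← Finset.mul_sum, Finset.sum_div]

theorem push_const_mul (r : ℝ) (t : V → ℝ) (i : V) :
    push G c (fun x => r * t x) i = r * push G c t i := by
  simp only [push, Finset.mul_sum]
  exact Finset.sum_congr rfl fun x _ => by ring

theorem push_mul_const (r : ℝ) (t : V → ℝ) (i : V) :
    push G c (fun x => t x * r) i = push G c t i * r := by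
  simp only [push, Finset.sum_mul]
  exact Finset.sum_congr rfl fun x _ => by ring

theorem push_mono {t t' : V → ℝ} (h : ∀ x, t x ≤ t' x) (i : V) :
    push G c t i ≤ push G c t' i := by
  unfold push
  refine Finset.sum_le_sum fun x _ => ?_
  have := h x
  gcongr

theorem push_nonneg {t : V → ℝ} (h : ∀ x, 0 ≤ t x) (i : V) : 0 ≤ push G c t i :=
  Finset.sum_nonneg fun x _ => by have := h x; positivity

/-- `push` averages over the in-neighbours and scales by √c. Equality fails only at a node without
in-neighbours, where the sum is empty. -/
theorem push_const_le {B : ℝ} (hB : 0 ≤ B) (i : V) : push G c (fun _ => B) i ≤ √c * B := by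
  unfold push
  rw [Finset.sum_const, nsmul_eq_mul]
  rcases (inNbrs G i).eq_empty_or_nonempty with h | h
  · simp only [h, Finset.card_empty, Nat.cast_zero, zero_mul]; positivity
  · have hpos : (0 : ℝ) < (inNbrs G i).card := by exact_mod_cast h.card_pos
    apply le_of_eq
    field_simp

theorem push_le {t : V → ℝ} {B : ℝ} (hB : 0 ≤ B) (h : ∀ x, t x ≤ B) (i : V) :
    push G c t i ≤ √c * B :=
  (push_mono G c h i).trans (push_const_le G c hB i)

theorem abs_push_le {t : V → ℝ} {B : ℝ} (hB : 0 ≤ B) (h : ∀ x, |t x| ≤ B) (i : V) :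
    |push G c t i| ≤ √c * B := by
  rw [abs_le]
  refine ⟨?_, push_le G c hB (fun x => (abs_le.1 (h x)).2) i⟩
  have h1 := push_le G c hB (t := fun x => -1 * t x) (fun x => by linarith [(abs_le.1 (h x)).1]) i
  rw [push_const_mul] at h1
  linarith

theorem push_push (hc : 0 ≤ c) (f : V → V → ℝ) (u v : V) :
    push G c (fun a => push G c (f a) v) u =
      c / ((inNbrs G u).card * (inNbrs G v).card) *
        ∑ a ∈ inNbrs G u, ∑ b ∈ inNbrs G v, f a b := by
  simp only [push, Finset.mul_sum, Finset.sum_div]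
  refine Finset.sum_congr rfl fun a _ => Finset.sum_congr rfl fun b _ => ?_
  -- The first two occurrences of `c` are under square roots; only the numerator on the right is
  -- split into √c · √c.
  nth_rewrite 3 [← Real.mul_self_sqrt hc]
  field_simp

end Push

/-! ### Hitting probabilities and the SimRank series. -/

section Hitting

variable {V : Type*} [Fintype V] [DecidableEq V] (G : Digraph V) [DecidableRel G.Adj] (c : ℝ)

/-- The probability that a `√c`-walk from `i` is at `k` at its `ℓ`-th step. -/
noncomputable def hitProb (k : V) : ℕ → V → ℝ
  | 0 => fun x => if x = k then 1 else 0
  | ℓ + 1 => push G c (hitProb k ℓ)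

theorem hitProb_nonneg (k : V) (ℓ : ℕ) (i : V) : 0 ≤ hitProb G c k ℓ i := by
  induction ℓ generalizing i with
  | zero => simp only [hitProb]; split_ifs <;> norm_num
  | succ ℓ ih => exact push_nonneg G c ih i

/-- A √c-walk survives ℓ steps with probability at most √c^ℓ. This keeps the number of nodes out of
the error bounds. -/
theorem sum_hitProb_le (ℓ : ℕ) (i : V) : ∑ k, hitProb G c k ℓ i ≤ √c ^ ℓ := by
  induction ℓ generalizing i with
  | zero => simp [hitProb]
  | succ ℓ ih =>
    simp only [hitProb]
    rw [← push_sum, pow_succ']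
    exact push_le G c (by positivity) ih i

theorem hitProb_le (k : V) (ℓ : ℕ) (i : V) : hitProb G c k ℓ i ≤ √c ^ ℓ :=
  (Finset.single_le_sum (f := fun k => hitProb G c k ℓ i)
    (fun k _ => hitProb_nonneg G c k ℓ i) (Finset.mem_univ k)).trans (sum_hitProb_le G c ℓ i)

variable {c}

/-- The probability that two independent `√c`-walks from `k` do not meet after their start. -/
noncomputable def correction (hc : c ∈ Set.Ioo (0 : ℝ) 1) (k : V) : ℝ :=
  1 - push G c (fun a => push G c (simRank G hc a) k) k

/-- `correction` is exactly the defect of the SimRank recursion on the diagonal; adding it gives one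
affine equation for all pairs. -/
theorem simRank_eq_push (hc : c ∈ Set.Ioo (0 : ℝ) 1) (i j : V) :
    simRank G hc i j = (if i = j then correction G hc j else 0) +
      push G c (fun a => push G c (simRank G hc a) j) i := by
  split_ifs with h
  · subst h; rw [simRank_eq, if_pos rfl, correction]; ring
  · rw [simRank_eq, if_neg h, push_push G c hc.1.le, zero_add]

/-- The SimRank series, truncated after `N` steps. -/
noncomputable def simRankPartial (hc : c ∈ Set.Ioo (0 : ℝ) 1) (N : ℕ) (i j : V) : ℝ :=
  ∑ ℓ ∈ range N, ∑ k, hitProb G c k ℓ i * correction G hc k * hitProb G c k ℓ j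

/-- The term ℓ = 0 is the diagonal correction, and shifting ℓ by one pushes in both arguments. -/
theorem simRankPartial_succ (hc : c ∈ Set.Ioo (0 : ℝ) 1) (N : ℕ) (i j : V) :
    simRankPartial G hc (N + 1) i j = (if i = j then correction G hc j else 0) +
      push G c (fun a => push G c (simRankPartial G hc N a) j) i := by
  unfold simRankPartial
  rw [Finset.sum_range_succ', add_comm]
  congr 1
  · simp [hitProb, Finset.sum_ite_eq]
  · have : (fun a => push G c (fun b => ∑ ℓ ∈ range N, ∑ k, hitProb G c k ℓ a *
        correction G hc k * hitProb G c k ℓ b) j) = fun a => ∑ ℓ ∈ range N, ∑ k,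
        hitProb G c k ℓ a * (correction G hc k * hitProb G c k (ℓ + 1) j) := by
      funext a
      rw [push_sum]
      refine Finset.sum_congr rfl fun ℓ _ => ?_
      rw [push_sum]
      refine Finset.sum_congr rfl fun k _ => ?_
      rw [push_const_mul, mul_assoc]
      rfl
    rw [this, push_sum]
    refine Finset.sum_congr rfl fun ℓ _ => ?_
    rw [push_sum]
    refine Finset.sum_congr rfl fun k _ => ?_
    rw [push_mul_const, mul_assoc]
    rfl

/-- Both functions obey the same affine recursion, so their difference is pushed twice per step and
shrinks by √c · √c = c. -/
theorem abs_simRank_sub_partial_le (hc : c ∈ Set.Ioo (0 : ℝ) 1)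
    (h01 : ∀ i j, simRank G hc i j ∈ Set.Icc (0 : ℝ) 1) (N : ℕ) (i j : V) :
    |simRank G hc i j - simRankPartial G hc N i j| ≤ c ^ N := by
  induction N generalizing i j with
  | zero =>
    have := h01 i j
    simpa [simRankPartial, abs_of_nonneg this.1] using this.2
  | succ N ih =>
    rw [simRank_eq_push, simRankPartial_succ, add_sub_add_left_eq_sub, push_sub]
    simp only [push_sub]
    have hcN : 0 ≤ c ^ N := pow_nonneg hc.1.le _
    refine (abs_push_le G c (by positivity)
      (fun a => abs_push_le G c hcN (ih a) j) i).trans (le_of_eq ?_)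
    rw [← mul_assoc, Real.mul_self_sqrt hc.1.le, pow_succ']

theorem correction_mem (hc : c ∈ Set.Ioo (0 : ℝ) 1)
    (h01 : ∀ i j, simRank G hc i j ∈ Set.Icc (0 : ℝ) 1) (k : V) :
    correction G hc k ∈ Set.Icc (0 : ℝ) 1 := by
  have h1 := push_nonneg G c (fun a => push_nonneg G c (fun b => (h01 a b).1) k) k
  have h2 := push_le G c (by positivity)
    (fun a => push_le G c zero_le_one (fun b => (h01 a b).2) k) k
  rw [mul_one, Real.mul_self_sqrt hc.1.le] at h2
  have := hc.2
  unfold correction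
  constructor <;> linarith

end Hitting

/-! ### Error caused by pruning and by inexact correction factors. -/

section Pruning

theorem prune_le {V : Type*} {θ : ℝ} {t : V → ℝ} {x : V} (h : 0 ≤ t x) : prune θ t x ≤ t x := by
  unfold prune; split_ifs <;> linarith

theorem prune_nonneg {V : Type*} {θ : ℝ} {t : V → ℝ} {x : V} (h : 0 ≤ t x) : 0 ≤ prune θ t x := by
  unfold prune; split_ifs <;> linarith

theorem sub_prune_le {V : Type*} {θ : ℝ} (hθ : 0 ≤ θ) (t : V → ℝ) (x : V) : t x - prune θ t x ≤ θ := by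
  unfold prune; split_ifs <;> linarith

variable {V : Type*} [Fintype V] [DecidableEq V] (G : Digraph V) [DecidableRel G.Adj] {c θ : ℝ}

theorem backwardTable_nonneg (k : V) (ℓ : ℕ) (x : V) : 0 ≤ backwardTable G c θ k ℓ x := by
  induction ℓ generalizing x with
  | zero => simp only [backwardTable]; split_ifs <;> norm_num
  | succ ℓ ih => exact push_nonneg G c (fun y => prune_nonneg (ih y)) x

theorem backwardTable_le_hitProb (k : V) (ℓ : ℕ) (x : V) :
    backwardTable G c θ k ℓ x ≤ hitProb G c k ℓ x := by
  induction ℓ generalizing x with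
  | zero => exact le_rfl
  | succ ℓ ih =>
    exact push_mono G c (fun y => (prune_le (backwardTable_nonneg G k ℓ y)).trans (ih y)) x

/-- A step scales the inherited error by √c and pruning adds at most θ, which gives a geometric sum.
It starts at 0 because θ < 1 spares the initial entry 1. -/
theorem hitProb_sub_prune_le (hs1 : √c < 1) (hθ : 0 < θ) (hθ1 : θ < 1) (k : V) (ℓ : ℕ) (x : V) :
    hitProb G c k ℓ x - prune θ (backwardTable G c θ k ℓ) x ≤
      (1 - √c ^ ℓ) / (1 - √c) * θ := by
  have hs0 : 0 ≤ √c := Real.sqrt_nonneg c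
  induction ℓ generalizing x with
  | zero =>
    simp only [hitProb, prune, backwardTable]
    split_ifs <;> · simp; try linarith
  | succ ℓ ih =>
    have hB : 0 ≤ (1 - √c ^ ℓ) / (1 - √c) * θ := by
      have : √c ^ ℓ ≤ 1 := pow_le_one₀ hs0 hs1.le
      exact mul_nonneg (div_nonneg (by linarith) (by linarith)) hθ.le
    have h1 : hitProb G c k (ℓ + 1) x - backwardTable G c θ k (ℓ + 1) x ≤
        √c * ((1 - √c ^ ℓ) / (1 - √c) * θ) := by
      simp only [hitProb, backwardTable]
      rw [push_sub]
      exact push_le G c hB ih x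
    have h2 := sub_prune_le hθ.le (backwardTable G c θ k (ℓ + 1)) x
    have h3 : (1 - √c ^ (ℓ + 1)) / (1 - √c) * θ = √c * ((1 - √c ^ ℓ) / (1 - √c) * θ) + θ := by
      have : 1 - √c ≠ 0 := by linarith
      field_simp
      ring
    linarith

theorem abs_step_sub_le (hc : c ∈ Set.Ioo (0 : ℝ) 1) (hθ : 0 < θ) (hθ1 : θ < 1)
    {d D : V → ℝ} {η : ℝ} (hd : ∀ k, |d k - D k| ≤ η)
    (hD : ∀ k, D k ∈ Set.Icc (0 : ℝ) 1) (ℓ : ℕ) (i j : V) :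
    |∑ k, prune θ (backwardTable G c θ k ℓ) i * d k * prune θ (backwardTable G c θ k ℓ) j
      - ∑ k, hitProb G c k ℓ i * D k * hitProb G c k ℓ j| ≤
      η * c ^ ℓ + 2 * θ / (1 - √c) * (√c ^ ℓ - c ^ ℓ) := by
  have hs0 : 0 ≤ √c := Real.sqrt_nonneg c
  have hs1 : √c < 1 := by
    rw [Real.sqrt_lt' one_pos]; simpa using hc.2
  set e := (1 - √c ^ ℓ) / (1 - √c) * θ with he
  have he0 : 0 ≤ e := by
    have : √c ^ ℓ ≤ 1 := pow_le_one₀ hs0 hs1.le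
    exact mul_nonneg (div_nonneg (by linarith) (by linarith)) hθ.le
  have hcℓ : √c ^ ℓ * √c ^ ℓ = c ^ ℓ := by rw [← mul_pow, Real.mul_self_sqrt hc.1.le]
  have hterm : ∀ k, |prune θ (backwardTable G c θ k ℓ) i * d k *
      prune θ (backwardTable G c θ k ℓ) j - hitProb G c k ℓ i * D k * hitProb G c k ℓ j| ≤
      hitProb G c k ℓ i * (√c ^ ℓ * η + e) + hitProb G c k ℓ j * e := by
    intro k
    have ha0 := prune_nonneg (θ := θ) (backwardTable_nonneg G (c := c) (θ := θ) k ℓ i)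
    have hb0 := prune_nonneg (θ := θ) (backwardTable_nonneg G (c := c) (θ := θ) k ℓ j)
    have ha1 := (prune_le (θ := θ) (backwardTable_nonneg G (c := c) (θ := θ) k ℓ i)).trans
      (backwardTable_le_hitProb G k ℓ i)
    have hb1 := (prune_le (θ := θ) (backwardTable_nonneg G (c := c) (θ := θ) k ℓ j)).trans
      (backwardTable_le_hitProb G k ℓ j)
    have hae := hitProb_sub_prune_le G hs1 hθ hθ1 k ℓ i
    have hbe := hitProb_sub_prune_le G hs1 hθ hθ1 k ℓ j
    have hj := hitProb_le G c k ℓ j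
    rw [← he] at hae hbe
    have hdk := hd k
    obtain ⟨hD0, hD1⟩ := hD k
    generalize prune θ (backwardTable G c θ k ℓ) i = a at *
    generalize prune θ (backwardTable G c θ k ℓ) j = b at *
    generalize hitProb G c k ℓ i = A at *
    generalize hitProb G c k ℓ j = B at *
    have hη : 0 ≤ η := (abs_nonneg _).trans hdk
    have h1 : |a * b * (d k - D k)| ≤ A * (√c ^ ℓ * η) := by
      rw [abs_mul, abs_of_nonneg (mul_nonneg ha0 hb0), mul_assoc]
      have : b ≤ √c ^ ℓ := hb1.trans hj
      have : 0 ≤ A := ha0.trans ha1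
      gcongr
    -- This term is D (AB - ab), telescoped so that each summand contains one pruning error.
    have h2 : |D k * ((A - a) * B + a * (B - b))| ≤ e * B + A * e := by
      have h3 : 0 ≤ (A - a) * B + a * (B - b) :=
        add_nonneg (mul_nonneg (by linarith) (by linarith)) (mul_nonneg ha0 (by linarith))
      rw [abs_of_nonneg (mul_nonneg hD0 h3)]
      refine (mul_le_of_le_one_left h3 hD1).trans (add_le_add ?_ ?_)
      · exact mul_le_mul_of_nonneg_right hae (by linarith)
      · exact mul_le_mul ha1 hbe (by linarith) (by linarith)
    calc |a * d k * b - A * D k * B|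
        = |a * b * (d k - D k) - D k * ((A - a) * B + a * (B - b))| := by congr 1; ring
      _ ≤ _ := abs_sub _ _
      _ ≤ _ := by linarith
  rw [← Finset.sum_sub_distrib]
  refine (Finset.abs_sum_le_sum_abs _ _).trans ((Finset.sum_le_sum fun k _ => hterm k).trans ?_)
  rw [Finset.sum_add_distrib, ← Finset.sum_mul, ← Finset.sum_mul]
  have hη : 0 ≤ η := (abs_nonneg _).trans (hd i)
  refine (add_le_add
    (mul_le_mul_of_nonneg_right (sum_hitProb_le G c ℓ i) (by positivity))
    (mul_le_mul_of_nonneg_right (sum_hitProb_le G c ℓ j) he0)).trans (le_of_eq ?_)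
  have : 1 - √c ≠ 0 := by linarith
  rw [he, ← hcℓ]
  field_simp
  ring

/-- Absent entries are 0, so the sum over common keys equals the full sum once N exceeds every
stored step. -/
theorem singlePairQuery_eq (hc : c ∈ Set.Ioo (0 : ℝ) 1) (hθ : 0 < θ) (d : V → ℝ) (i j : V) :
    ∃ N₀, ∀ N ≥ N₀, singlePairQuery d (hpIndex G hc hθ i) (hpIndex G hc hθ j) =
      ∑ ℓ ∈ range N, ∑ k, prune θ (backwardTable G c θ k ℓ) i * d k *
        prune θ (backwardTable G c θ k ℓ) j := by
  refine ⟨(hpIndex G hc hθ i).support.sup (fun p => p.1 + 1), fun N hN => ?_⟩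
  rw [← Finset.sum_product' (f := fun ℓ k => prune θ (backwardTable G c θ k ℓ) i * d k *
    prune θ (backwardTable G c θ k ℓ) j)]
  unfold singlePairQuery
  have happ : ∀ (v : V) (p : ℕ × V), hpIndex G hc hθ v p =
    prune θ (backwardTable G c θ p.2 p.1) v := fun _ _ => rfl
  have hsub : (hpIndex G hc hθ i).support ⊆ range N ×ˢ univ := fun p hp => by
    have := Finset.le_sup (f := fun p : ℕ × V => p.1 + 1) hp
    simp only [mem_product, mem_range, mem_univ, and_true]
    omega
  rw [← Finset.sum_subset hsub]
  · refine Finset.sum_congr rfl fun p _ => ?_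
    split_ifs with h
    · simp only [happ]
    · rw [Finsupp.notMem_support_iff, happ] at h
      rw [h, mul_zero]
  · intro p _ hp
    rw [Finsupp.notMem_support_iff, happ] at hp
    rw [hp, zero_mul, zero_mul]

theorem abs_singlePairQuery_sub_simRank_le (hc : c ∈ Set.Ioo (0 : ℝ) 1) (hθ : 0 < θ)
    (hθ1 : θ < 1) (h01 : ∀ i j, simRank G hc i j ∈ Set.Icc (0 : ℝ) 1)
    {d : V → ℝ} {η : ℝ} (hd : ∀ k, |d k - correction G hc k| ≤ η) (i j : V) :
    |singlePairQuery d (hpIndex G hc hθ i) (hpIndex G hc hθ j) - simRank G hc i j| ≤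
      η / (1 - c) + 2 * √c / ((1 - √c) * (1 - c)) * θ := by
  have hs0 : 0 ≤ √c := Real.sqrt_nonneg c
  have hs1 : √c < 1 := by
    rw [Real.sqrt_lt' one_pos]; simpa using hc.2
  have hη : 0 ≤ η := (abs_nonneg _).trans (hd i)
  obtain ⟨N₀, hN₀⟩ := singlePairQuery_eq G hc hθ d i j
  have hsum : HasSum (fun ℓ => η * c ^ ℓ + 2 * θ / (1 - √c) * (√c ^ ℓ - c ^ ℓ))
      (η / (1 - c) + 2 * √c / ((1 - √c) * (1 - c)) * θ) := by
    have h1 := hasSum_geometric_of_lt_one hc.1.le hc.2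
    have h2 := hasSum_geometric_of_lt_one hs0 hs1
    have h3 : (1 - √c) ≠ 0 := by linarith
    have h4 : (1 - c) ≠ 0 := by linarith [hc.2]
    -- The value of ∑ (√c^ℓ - c^ℓ), the source of the factor √c in the bound.
    have h5 : (1 - √c)⁻¹ - (1 - c)⁻¹ = √c / (1 - c) := by
      have : (1 - √c) * (1 + √c) = 1 - c := by
        have := Real.mul_self_sqrt hc.1.le
        linarith
      have h6 : (1 + √c) ≠ 0 := by linarith
      rw [← this]
      field_simp
      ring
    have h := (h1.mul_left η).add ((h2.sub h1).mul_left (2 * θ / (1 - √c)))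
    rw [h5] at h
    have hval : η * (1 - c)⁻¹ + 2 * θ / (1 - √c) * (√c / (1 - c)) =
        η / (1 - c) + 2 * √c / ((1 - √c) * (1 - c)) * θ := by field_simp
    rwa [hval] at h
  have hlim := hsum.tendsto_sum_nat.add (tendsto_pow_atTop_nhds_zero_of_lt_one hc.1.le hc.2)
  rw [add_zero] at hlim
  -- For every large N the error is at most the N-th partial sum of the stepwise bounds plus the
  -- truncation error c^N, which tends to 0.
  refine ge_of_tendsto hlim (Filter.eventually_atTop.2 ⟨N₀, fun N hN => ?_⟩)
  have hR := abs_simRank_sub_partial_le G hc h01 N i j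
  rw [abs_sub_comm] at hR
  refine (abs_sub_le _ (simRankPartial G hc N i j) _).trans (add_le_add ?_ hR)
  rw [hN₀ N hN, simRankPartial, ← Finset.sum_sub_distrib]
  exact (Finset.abs_sum_le_sum_abs _ _).trans (Finset.sum_le_sum fun ℓ _ =>
    abs_step_sub_le G hc hθ hθ1 hd (correction_mem G hc h01) ℓ i j)

end Pruning

/-! ### Expectations under a `PMF`. -/

section PMFExpectation

variable {α β : Type*}

theorem tsum_bind_mul (p : PMF α) (f : α → PMF β) (g : β → ℝ≥0∞) :
    ∑' b, p.bind f b * g b = ∑' a, p a * ∑' b, f a b * g b := by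
  simp only [PMF.bind_apply, ← ENNReal.tsum_mul_right, ← ENNReal.tsum_mul_left]
  rw [ENNReal.tsum_comm]
  exact tsum_congr fun a => tsum_congr fun b => by rw [mul_assoc]

theorem tsum_pure_mul (a : α) (g : α → ℝ≥0∞) : ∑' b, PMF.pure a b * g b = g a := by
  rw [tsum_eq_single a]
  · simp
  · intro b hb; simp [hb]

theorem tsum_uniformOfFinset_mul (S : Finset α) (hS : S.Nonempty) (g : α → ℝ≥0∞) :
    ∑' a, PMF.uniformOfFinset S hS a * g a = (S.card : ℝ≥0∞)⁻¹ * ∑ a ∈ S, g a := by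
  rw [tsum_eq_sum (s := S), Finset.mul_sum]
  · exact Finset.sum_congr rfl fun a ha => by rw [PMF.uniformOfFinset_apply_of_mem hS ha]
  · intro a ha; rw [PMF.uniformOfFinset_apply_of_notMem hS ha, zero_mul]

end PMFExpectation

/-! ### SimRank as a meeting probability. -/

section Meeting

variable {V : Type*} [Fintype V] [DecidableEq V] (G : Digraph V) [DecidableRel G.Adj] (c : ℝ)

open Classical in
/-- The probability that independent `√c`-walks from `u` and `v` meet. -/
noncomputable def meetProb (u v : V) : ℝ≥0∞ :=
  ∑' l, ∑' l', walkWeight G c u l * walkWeight G c v l' *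
    if Meet (u :: l) (v :: l') then 1 else 0

theorem meet_cons_self {V : Type*} (u : V) (l l' : List V) : Meet (u :: l) (u :: l') :=
  ⟨0, u, rfl, rfl⟩

theorem meet_cons_iff {V : Type*} {u v : V} (h : u ≠ v) (l l' : List V) :
    Meet (u :: l) (v :: l') ↔ Meet l l' := by
  constructor
  · rintro ⟨ℓ, w, h1, h2⟩
    cases ℓ with
    | zero =>
      simp only [List.getElem?_cons_zero, Option.some.injEq] at h1 h2
      exact absurd (h1.trans h2.symm) h
    | succ ℓ => exact ⟨ℓ, w, by simpa using h1, by simpa using h2⟩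
  · rintro ⟨ℓ, w, h1, h2⟩
    exact ⟨ℓ + 1, w, by simpa using h1, by simpa using h2⟩

theorem not_meet_nil_left {V : Type*} (l : List V) : ¬ Meet [] l := by
  rintro ⟨ℓ, w, h1, -⟩; simp at h1

theorem not_meet_nil_right {V : Type*} (l : List V) : ¬ Meet l [] := by
  rintro ⟨ℓ, w, -, h1⟩; simp at h1

variable {c}

theorem tsum_walkWeight_mul (hc : c ∈ Set.Ioo (0 : ℝ) 1) (u v : V) :
    ∑' l, ∑' l', walkWeight G c u l * walkWeight G c v l' = 1 := by
  simp only [ENNReal.tsum_mul_left, tsum_walkWeight G hc, mul_one]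

theorem meetProb_self (hc : c ∈ Set.Ioo (0 : ℝ) 1) (u : V) : meetProb G c u u = 1 := by
  simp only [meetProb, meet_cons_self, if_true, mul_one, tsum_walkWeight_mul G hc]

theorem meetProb_le_one (hc : c ∈ Set.Ioo (0 : ℝ) 1) (u v : V) : meetProb G c u v ≤ 1 := by
  rw [← tsum_walkWeight_mul G hc u v]
  refine ENNReal.tsum_le_tsum fun l => ENNReal.tsum_le_tsum fun l' => ?_
  split_ifs <;> simp

/-- Distinct starts cannot meet at step 0, so both walks must move; condition on their first moves.
-/
theorem meetProb_of_ne {u v : V} (h : u ≠ v) :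
    meetProb G c u v = ∑ a, ∑ b, moveProb G c u a * moveProb G c v b * meetProb G c a b := by
  unfold meetProb
  have hmeet : ∀ l l', Meet (u :: l) (v :: l') ↔ Meet l l' := meet_cons_iff h
  classical
  simp only [hmeet]
  rw [tsum_list_eq]
  simp only [not_meet_nil_left, if_false, mul_zero, tsum_zero, zero_add, tsum_fintype]
  refine Finset.sum_congr rfl fun a _ => ?_
  have h1 : ∀ l, (∑' l', walkWeight G c u (a :: l) * walkWeight G c v l' *
      if Meet (a :: l) l' then 1 else 0) = ∑ b, ∑' l', moveProb G c u a * moveProb G c v b *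
        (walkWeight G c a l * walkWeight G c b l' *
          if Meet (a :: l) (b :: l') then 1 else 0) := by
    intro l
    rw [tsum_list_eq]
    simp only [not_meet_nil_right, if_false, mul_zero, zero_add, tsum_fintype]
    refine Finset.sum_congr rfl fun b _ => tsum_congr fun l' => ?_
    simp only [walkWeight]
    ring
  simp only [h1]
  rw [Summable.tsum_finsetSum fun _ _ => ENNReal.summable]
  simp only [ENNReal.tsum_mul_left]

/-- Meeting probabilities solve the SimRank equations, whose solution is unique. -/
theorem simRank_eq_meetProb (hc : c ∈ Set.Ioo (0 : ℝ) 1) (u v : V) :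
    simRank G hc u v = (meetProb G c u v).toReal := by
  have hfin : ∀ a b, meetProb G c a b ≠ ∞ := fun a b =>
    ne_top_of_le_ne_top ENNReal.one_ne_top (meetProb_le_one G hc a b)
  have hsol : ∀ u v, (meetProb G c u v).toReal =
      simRankRHS G c (fun a b => (meetProb G c a b).toReal) u v := by
    intro u v
    unfold simRankRHS
    split_ifs with h
    · rw [h, meetProb_self G hc, ENNReal.toReal_one]
    · rw [← push_push G c hc.1.le, meetProb_of_ne G h]
      have hmove : ∀ u a : V, moveProb G c u a ≠ ∞ := fun u a => by
        unfold moveProb; split_ifs <;> simp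
      rw [ENNReal.toReal_sum fun a _ => ENNReal.sum_ne_top.2 fun b _ =>
        ENNReal.mul_ne_top (ENNReal.mul_ne_top (hmove _ _) (hmove _ _)) (hfin _ _)]
      have hpush : ∀ (t : V → ℝ) (w : V),
          push G c t w = ∑ a, (moveProb G c w a).toReal * t a := fun t w => by
        unfold push moveProb
        rw [← Finset.sum_subset (Finset.subset_univ (inNbrs G w))]
        · refine Finset.sum_congr rfl fun a ha => ?_
          rw [if_pos ha, ENNReal.toReal_ofReal (by positivity)]
          ring
        · intro a _ ha
          rw [if_neg ha, ENNReal.toReal_zero, zero_mul]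
      rw [hpush]
      refine Finset.sum_congr rfl fun a _ => ?_
      rw [ENNReal.toReal_sum fun b _ =>
        ENNReal.mul_ne_top (ENNReal.mul_ne_top (hmove _ _) (hmove _ _)) (hfin _ _), hpush,
        Finset.mul_sum]
      exact Finset.sum_congr rfl fun b _ => by rw [ENNReal.toReal_mul, ENNReal.toReal_mul, mul_assoc]
  exact (congrFun (congrFun ((existsUnique_simRank G hc).choose_spec.2 _ hsol) u) v).symm

theorem simRank_mem_Icc (hc : c ∈ Set.Ioo (0 : ℝ) 1) (u v : V) :
    simRank G hc u v ∈ Set.Icc (0 : ℝ) 1 := by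
  rw [simRank_eq_meetProb]
  exact ⟨ENNReal.toReal_nonneg,
    ENNReal.toReal_le_of_le_ofReal zero_le_one (by simpa using meetProb_le_one G hc u v)⟩

/-- The law of the nodes that a `√c`-walk from `u` visits after its start. -/
noncomputable def walkTail (hc : c ∈ Set.Ioo (0 : ℝ) 1) (u : V) : PMF (List V) :=
  ⟨walkWeight G c u, tsum_walkWeight G hc u ▸ ENNReal.summable.hasSum⟩

open Classical in
theorem sqrtCWalk_pair_apply_one (hc : c ∈ Set.Ioo (0 : ℝ) 1) (u v : V) :
    ((sqrtCWalk G hc u).bind fun W => (sqrtCWalk G hc v).bind fun W' =>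
      if Meet W W' then PMF.pure (1 : ℕ) else PMF.pure 0) 1 = meetProb G c u v := by
  have hmap : ∀ w, sqrtCWalk G hc w = PMF.map (fun l => w :: l) (walkTail G hc w) := fun _ => rfl
  have happ : ∀ w l, walkTail G hc w l = walkWeight G c w l := fun _ _ => rfl
  unfold meetProb
  rw [hmap, hmap, PMF.bind_map, PMF.bind_apply]
  refine tsum_congr fun l => ?_
  simp only [Function.comp_apply, happ]
  rw [PMF.bind_map, PMF.bind_apply, ← ENNReal.tsum_mul_left]
  refine tsum_congr fun l' => ?_
  rw [mul_assoc, happ]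
  refine congrArg₂ _ rfl (congrArg₂ _ rfl ?_)
  simp only [Function.comp_apply]
  split_ifs <;> simp

end Meeting

/-! ### Concentration of the sampled correction factors. -/

section Sampling

variable {V : Type*} [Fintype V] [DecidableEq V] (G : Digraph V) [DecidableRel G.Adj] {c : ℝ}

theorem sampleRound_apply_one (hc : c ∈ Set.Ioo (0 : ℝ) 1) (S : Finset V) (hS : S.Nonempty) :
    sampleRound G hc S hS 1 = (S.card : ℝ≥0∞)⁻¹ * ∑ a ∈ S, ((S.card : ℝ≥0∞)⁻¹ * ∑ b ∈ S,
      if a ≠ b then meetProb G c a b else 0) := by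
  unfold sampleRound
  rw [PMF.bind_apply, tsum_uniformOfFinset_mul]
  congr 1
  refine Finset.sum_congr rfl fun a _ => ?_
  rw [PMF.bind_apply, tsum_uniformOfFinset_mul]
  congr 1
  refine Finset.sum_congr rfl fun b _ => ?_
  split_ifs
  · exact sqrtCWalk_pair_apply_one G hc a b
  · simp

/-- Together with the value at 1, this makes a round a Bernoulli variable. -/
theorem sampleRound_apply_add_two (hc : c ∈ Set.Ioo (0 : ℝ) 1) (S : Finset V) (hS : S.Nonempty)
    (m : ℕ) : sampleRound G hc S hS (m + 2) = 0 := by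
  by_contra h
  have := (PMF.mem_support_iff _ _).2 h
  simp only [sampleRound, PMF.mem_support_bind_iff] at this
  obtain ⟨a, -, b, -, h⟩ := this
  split_ifs at h
  · simp only [PMF.mem_support_bind_iff] at h
    obtain ⟨W, -, W', -, h⟩ := h
    split_ifs at h <;> simp at h
  · simp at h

/-- In the double sum over I(k), the diagonal pairs contribute c/|I(k)|; the others give c times the
probability that a round succeeds. -/
theorem correction_eq (hc : c ∈ Set.Ioo (0 : ℝ) 1) (k : V) (h : (inNbrs G k).Nonempty) :
    correction G hc k = 1 - c / (inNbrs G k).card -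
      c * (sampleRound G hc (inNbrs G k) h 1).toReal := by
  have hfin : ∀ a b, meetProb G c a b ≠ ∞ := fun a b =>
    ne_top_of_le_ne_top ENNReal.one_ne_top (meetProb_le_one G hc a b)
  have hpos : (0 : ℝ) < (inNbrs G k).card := by exact_mod_cast h.card_pos
  have hval : (sampleRound G hc (inNbrs G k) h 1).toReal = ((inNbrs G k).card : ℝ)⁻¹ *
      ∑ a ∈ inNbrs G k, (((inNbrs G k).card : ℝ)⁻¹ * ∑ b ∈ inNbrs G k,
        if a ≠ b then simRank G hc a b else 0) := by
    have hite : ∀ a b, (if a ≠ b then meetProb G c a b else 0) ≠ ∞ := fun a b => by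
      split_ifs <;> simp [hfin]
    have hcard : ((inNbrs G k).card : ℝ≥0∞)⁻¹ ≠ ∞ := by
      simpa using h.ne_empty
    rw [sampleRound_apply_one, ENNReal.toReal_mul, ENNReal.toReal_sum fun a _ =>
      ENNReal.mul_ne_top hcard (ENNReal.sum_ne_top.2 fun b _ => hite a b)]
    simp only [ENNReal.toReal_mul, ENNReal.toReal_inv, ENNReal.toReal_natCast]
    congr 1
    refine Finset.sum_congr rfl fun a _ => ?_
    rw [ENNReal.toReal_sum fun b _ => hite a b]
    congr 1
    refine Finset.sum_congr rfl fun b _ => ?_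
    rw [simRank_eq_meetProb]
    split_ifs <;> simp
  have hdiag : ∀ a ∈ inNbrs G k, ∑ b ∈ inNbrs G k, simRank G hc a b =
      1 + ∑ b ∈ inNbrs G k, if a ≠ b then simRank G hc a b else 0 := fun a ha => by
    rw [← Finset.add_sum_erase _ _ ha, ← Finset.add_sum_erase (inNbrs G k) _ ha,
      if_neg (not_not.2 rfl), zero_add, simRank_eq, if_pos rfl]
    congr 1
    exact Finset.sum_congr rfl fun b hb => by rw [if_pos (Finset.ne_of_mem_erase hb).symm]
  rw [correction, push_push G c hc.1.le, Finset.sum_congr rfl hdiag, Finset.sum_add_distrib, hval,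
    ← Finset.mul_sum, Finset.sum_const, nsmul_eq_mul]
  field_simp
  ring

/-- A centred Bernoulli variable is sub-Gaussian. -/
theorem bernoulli_mgf_le {p : ℝ} (hp : p ∈ Set.Icc (0 : ℝ) 1) (t : ℝ) :
    1 - p + p * Real.exp t ≤ Real.exp (t * p + t ^ 2 / 2) := by
  obtain ⟨h0, h1⟩ := hp
  -- The factor exp(-tp) is bounded by the moment generating function at -t. Its product with the
  -- one at t is 1 + 2p(1-p)(cosh t - 1) ≤ cosh t ≤ exp(t²/2).
  have hconv : Real.exp (-(t * p)) ≤ 1 - p + p * Real.exp (-t) := by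
    have := convexOn_exp.2 (Set.mem_univ 0) (Set.mem_univ (-t)) (sub_nonneg.2 h1) h0 (by ring)
    simp only [smul_eq_mul, mul_zero, zero_add, Real.exp_zero, mul_one] at this
    rwa [mul_neg, mul_comm p t] at this
  have hcosh := Real.cosh_le_exp_half_sq t
  have hcosh1 := Real.one_le_cosh t
  have hprod : Real.exp t * Real.exp (-t) = 1 := by rw [← Real.exp_add]; simp
  have hnn : 0 ≤ 1 - p + p * Real.exp t := by
    have := mul_nonneg h0 (Real.exp_pos t).le
    linarith
  have hmain : (1 - p + p * Real.exp t) * Real.exp (-(t * p)) ≤ Real.exp (t ^ 2 / 2) := by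
    refine (mul_le_mul_of_nonneg_left hconv hnn).trans (le_trans ?_ hcosh)
    have hx : Real.exp t + Real.exp (-t) = 2 * Real.cosh t := by rw [Real.cosh_eq]; ring
    have : (1 - p + p * Real.exp t) * (1 - p + p * Real.exp (-t)) =
        (1 - 2 * (p * (1 - p))) + 2 * (p * (1 - p)) * Real.cosh t := by
      linear_combination p ^ 2 * hprod + p * (1 - p) * hx
    rw [this]
    -- The slack is (cosh t - 1)(p² + (1-p)²).
    nlinarith [mul_nonneg (sub_nonneg.2 hcosh1) (add_nonneg (sq_nonneg p) (sq_nonneg (1 - p)))]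
  calc 1 - p + p * Real.exp t
      = (1 - p + p * Real.exp t) * Real.exp (-(t * p)) * Real.exp (t * p) := by
        rw [mul_assoc, ← Real.exp_add]; simp
    _ ≤ Real.exp (t ^ 2 / 2) * Real.exp (t * p) := by gcongr
    _ = _ := by rw [← Real.exp_add, add_comm]

theorem tsum_sampleRound_mul_exp_le (hc : c ∈ Set.Ioo (0 : ℝ) 1) (S : Finset V)
    (hS : S.Nonempty) (t : ℝ) :
    ∑' b, sampleRound G hc S hS b * ENNReal.ofReal (Real.exp (t * b)) ≤
      ENNReal.ofReal (Real.exp (t * (sampleRound G hc S hS 1).toReal + t ^ 2 / 2)) := by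
  set q := sampleRound G hc S hS with hq
  have hzero : ∀ b ∉ Finset.range 2, q b = 0 := fun b hb => by
    rw [Finset.mem_range, not_lt] at hb
    obtain ⟨m, rfl⟩ := Nat.exists_eq_add_of_le' hb
    exact sampleRound_apply_add_two G hc S hS m
  have htot : q 0 + q 1 = 1 := by
    rw [← q.tsum_coe, tsum_eq_sum hzero, Finset.sum_range_succ, Finset.sum_range_one]
  have hfin := q.apply_ne_top
  have hreal : (q 0).toReal = 1 - (q 1).toReal := by
    rw [eq_sub_iff_add_eq, ← ENNReal.toReal_add (hfin 0) (hfin 1), htot, ENNReal.toReal_one]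
  have h1 : (q 1).toReal ≤ 1 := by linarith [ENNReal.toReal_nonneg (a := q 0)]
  rw [tsum_eq_sum (s := Finset.range 2) fun b hb => by rw [hzero b hb, zero_mul],
    Finset.sum_range_succ, Finset.sum_range_one]
  refine le_trans (le_of_eq ?_)
    (ENNReal.ofReal_le_ofReal (bernoulli_mgf_le ⟨ENNReal.toReal_nonneg, h1⟩ t))
  rw [← hreal, ENNReal.ofReal_add ENNReal.toReal_nonneg
    (mul_nonneg ENNReal.toReal_nonneg (Real.exp_pos _).le),
    ENNReal.ofReal_mul ENNReal.toReal_nonneg, ENNReal.ofReal_toReal (hfin 0),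
    ENNReal.ofReal_toReal (hfin 1)]
  simp

/-- Independent rounds multiply the moment generating functions. -/
theorem tsum_sampleCount_mul_exp_le (hc : c ∈ Set.Ioo (0 : ℝ) 1) (S : Finset V)
    (hS : S.Nonempty) (t : ℝ) (n : ℕ) :
    ∑' x, sampleCount G hc S hS n x * ENNReal.ofReal (Real.exp (t * x)) ≤
      ENNReal.ofReal (Real.exp (n * (t * (sampleRound G hc S hS 1).toReal + t ^ 2 / 2))) := by
  induction n with
  | zero => simp [sampleCount]
  | succ n ih =>
    simp only [sampleCount, tsum_bind_mul, tsum_pure_mul]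
    have hsplit : ∀ x b : ℕ, ENNReal.ofReal (Real.exp (t * ((x + b : ℕ) : ℝ))) =
        ENNReal.ofReal (Real.exp (t * x)) * ENNReal.ofReal (Real.exp (t * b)) := fun x b => by
      rw [← ENNReal.ofReal_mul (Real.exp_pos _).le, ← Real.exp_add]
      push_cast
      rw [mul_add]
    simp only [hsplit, mul_left_comm (sampleRound G hc S hS _), ENNReal.tsum_mul_left]
    simp only [← mul_assoc, ENNReal.tsum_mul_right]
    refine (mul_le_mul' ih (tsum_sampleRound_mul_exp_le G hc S hS t)).trans (le_of_eq ?_)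
    rw [← ENNReal.ofReal_mul (Real.exp_pos _).le, ← Real.exp_add]
    push_cast
    ring_nf

/-- A Hoeffding bound for the relative frequency of the rounds in which the walks meet. -/
theorem sampleCount_toMeasure_le (hc : c ∈ Set.Ioo (0 : ℝ) 1) (S : Finset V) (hS : S.Nonempty)
    {n : ℕ} (hn : 0 < n) {η : ℝ} (hη : 0 ≤ η) :
    (sampleCount G hc S hS n).toMeasure
      {x | η < |(x : ℝ) / n - (sampleRound G hc S hS 1).toReal|} ≤
      ENNReal.ofReal (2 * Real.exp (-(n * η ^ 2 / 2))) := by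
  set p := (sampleRound G hc S hS 1).toReal
  have hn' : (0 : ℝ) < n := by exact_mod_cast hn
  rw [PMF.toMeasure_apply_eq_tsum]
  -- Chernoff at t = ±η, which minimises t²/2 - |t|η: on the bad event one of the two exponential
  -- weights is at least 1.
  have hpt : ∀ x, Set.indicator {x : ℕ | η < |(x : ℝ) / n - p|} (sampleCount G hc S hS n) x ≤
      sampleCount G hc S hS n x * ENNReal.ofReal (Real.exp (η * x)) *
        ENNReal.ofReal (Real.exp (-(n * (η * p + η ^ 2)))) +
      sampleCount G hc S hS n x * ENNReal.ofReal (Real.exp (-η * x)) *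
        ENNReal.ofReal (Real.exp (n * (η * p - η ^ 2))) := by
    intro x
    rw [Set.indicator_apply]
    split_ifs with hx
    swap
    · exact bot_le
    rw [mul_assoc, mul_assoc, ← mul_add, ← ENNReal.ofReal_mul (Real.exp_pos _).le,
      ← ENNReal.ofReal_mul (Real.exp_pos _).le, ← Real.exp_add, ← Real.exp_add]
    refine le_mul_of_one_le_right bot_le ?_
    have hx' : η < |(x : ℝ) / n - p| := hx
    rcases lt_abs.1 hx' with h | h
    · refine (ENNReal.one_le_ofReal.2 (Real.one_le_exp ?_)).trans le_self_add
      have h1 : n * (η + p) ≤ x := by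
        rw [lt_sub_iff_add_lt, lt_div_iff₀ hn'] at h; linarith
      nlinarith [mul_le_mul_of_nonneg_left h1 hη]
    · refine (ENNReal.one_le_ofReal.2 (Real.one_le_exp ?_)).trans le_add_self
      have h1 : x ≤ n * (p - η) := by
        have : (x : ℝ) / n < p - η := by linarith
        rw [div_lt_iff₀ hn'] at this; linarith
      nlinarith [mul_le_mul_of_nonneg_left h1 hη]
  refine (ENNReal.tsum_le_tsum hpt).trans ?_
  rw [ENNReal.tsum_add, ENNReal.tsum_mul_right, ENNReal.tsum_mul_right]
  refine (add_le_add (mul_le_mul_left (tsum_sampleCount_mul_exp_le G hc S hS η n) _)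
    (mul_le_mul_left (tsum_sampleCount_mul_exp_le G hc S hS (-η) n) _)).trans (le_of_eq ?_)
  rw [← ENNReal.ofReal_mul (Real.exp_pos _).le, ← ENNReal.ofReal_mul (Real.exp_pos _).le,
    ← ENNReal.ofReal_add (by positivity) (by positivity), ← Real.exp_add, ← Real.exp_add, two_mul]
  congr 3 <;> ring

/-- Up to rounding, the exponent is (1 + εd/(2c)) log(2/δd); the summand c·εd in the sample size is
slack. -/
theorem two_mul_exp_numSamples_le (hc : 0 < c) {εd δd : ℝ} (hεd : 0 < εd) (hδd : 0 < δd)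
    (hδd2 : δd ≤ 2) :
    2 * Real.exp (-(numSamples c εd δd * (εd / c) ^ 2 / 2)) ≤ δd := by
  have hlog : 0 ≤ Real.log (2 / δd) := Real.log_nonneg ((one_le_div hδd).2 hδd2)
  have hn : (2 * c ^ 2 + c * εd) / εd ^ 2 * Real.log (2 / δd) ≤ numSamples c εd δd :=
    Nat.le_ceil _
  have hexp : Real.log (2 / δd) ≤ numSamples c εd δd * (εd / c) ^ 2 / 2 := by
    calc Real.log (2 / δd) ≤ (1 + εd / (2 * c)) * Real.log (2 / δd) :=
          le_mul_of_one_le_left hlog (by have : 0 ≤ εd / (2 * c) := by positivity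
                                         linarith)
      _ = (2 * c ^ 2 + c * εd) / εd ^ 2 * Real.log (2 / δd) * (εd / c) ^ 2 / 2 := by
        field_simp
      _ ≤ _ := by gcongr
  calc 2 * Real.exp (-(numSamples c εd δd * (εd / c) ^ 2 / 2))
      ≤ 2 * Real.exp (-Real.log (2 / δd)) := by gcongr
    _ = δd := by
      rw [Real.exp_neg, Real.exp_log (by positivity)]
      field_simp

theorem estimateCorrection_toMeasure_le (hc : c ∈ Set.Ioo (0 : ℝ) 1) {εd δd : ℝ} (hεd : 0 < εd)
    (hδd : 0 < δd) (k : V) :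
    (estimateCorrection G hc εd δd k).toMeasure {x | εd < |x - correction G hc k|} ≤
      ENNReal.ofReal δd := by
  -- For δd ≥ 2 the sample size is 0, but the bound exceeds 1 and is trivial.
  rcases le_or_gt 2 δd with h2 | h2
  · refine MeasureTheory.prob_le_one.trans (ENNReal.one_le_ofReal.2 (by linarith))
  have hmeas : MeasurableSet {x : ℝ | εd < |x - correction G hc k|} :=
    (isOpen_lt continuous_const (by fun_prop)).measurableSet
  unfold estimateCorrection
  split_ifs with h
  · have hn : 0 < numSamples c εd δd := Nat.ceil_pos.2 (by
      have := hc.1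
      have hlog : 0 < Real.log (2 / δd) := Real.log_pos ((one_lt_div hδd).2 h2)
      positivity)
    -- The cast of the counter in `estimateCorrection` is elaborated as a monadic coercion to `PMF
    -- ℝ`; it is the pushforward under `Nat.cast`.
    have hcast : (do let a ← sampleCount G hc (inNbrs G k) h (numSamples c εd δd); pure (a : ℝ)) =
        PMF.map Nat.cast (sampleCount G hc (inNbrs G k) h (numSamples c εd δd)) := rfl
    rw [hcast, PMF.map_comp, PMF.toMeasure_map_apply _ _ _ (measurable_of_countable _) hmeas]
    refine le_trans (MeasureTheory.measure_mono fun x hx => ?_)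
      ((sampleCount_toMeasure_le G hc _ h hn (div_nonneg hεd.le hc.1.le)).trans
        (ENNReal.ofReal_le_ofReal (two_mul_exp_numSamples_le hc.1 hεd hδd h2.le)))
    simp only [Set.mem_preimage, Set.mem_ofPred_eq, Function.comp_apply] at hx ⊢
    -- The deviation of the estimate is c times that of the frequency, hence the threshold εd/c.
    rw [correction_eq G hc k h, sub_sub_sub_cancel_left, ← mul_sub, abs_mul, abs_of_pos hc.1,
      abs_sub_comm] at hx
    rw [div_lt_iff₀ hc.1, mul_comm]
    exact hx
  · have h1 : correction G hc k = 1 := by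
      rw [Finset.not_nonempty_iff_eq_empty] at h
      simp [correction, push, h]
    rw [PMF.toMeasure_pure, MeasureTheory.Measure.dirac_apply' _ hmeas, h1]
    simp [hεd.le]

end Sampling

end Sling

/-! ### Union bound over the nodes. -/

theorem theorem1 {V : Type*} [Fintype V] [DecidableEq V] (G : Digraph V) [DecidableRel G.Adj]
    {c εd δd θ ε δ : ℝ} (hc : c ∈ Set.Ioo (0 : ℝ) 1)
    (hεd : 0 < εd) (hδd : 0 < δd) (hθ : 0 < θ) (hθ1 : θ < 1)
    {Ω : Type*} [MeasurableSpace Ω] (P : MeasureTheory.Measure Ω)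
    [MeasureTheory.IsProbabilityMeasure P]
    (d : V → Ω → ℝ)
    (hd : ∀ k, ProbabilityTheory.HasLaw (d k) (Sling.estimateCorrection G hc εd δd k).toMeasure P)
    (hδ : δd ≤ δ / (Fintype.card V : ℝ))
    (hε : εd / (1 - c) + 2 * √c / ((1 - √c) * (1 - c)) * θ ≤ ε) :
    ENNReal.ofReal (1 - δ) ≤
      P {ω | ∀ i j : V,
        |Sling.singlePairQuery (fun k => d k ω) (Sling.hpIndex G hc hθ i) (Sling.hpIndex G hc hθ j)
          - Sling.simRank G hc i j| ≤ ε} := by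
  set A := {ω | ∀ i j : V,
    |Sling.singlePairQuery (fun k => d k ω) (Sling.hpIndex G hc hθ i) (Sling.hpIndex G hc hθ j)
      - Sling.simRank G hc i j| ≤ ε}
  -- For empty `V`, division by zero would give δ/0 = 0, against 0 < δd.
  have hcard : (0 : ℝ) < Fintype.card V := by
    rcases Nat.eq_zero_or_pos (Fintype.card V) with h | h
    · rw [h, Nat.cast_zero, div_zero] at hδ; linarith
    · exact_mod_cast h
  have hδ' : (Fintype.card V : ℝ) * δd ≤ δ := by
    rw [le_div_iff₀ hcard] at hδ; linarith
  -- Only the marginal laws enter; the estimates need not be independent across nodes.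
  have hbad : P (⋃ k, {ω | εd < |d k ω - Sling.correction G hc k|}) ≤ ENNReal.ofReal δ := by
    refine (MeasureTheory.measure_iUnion_fintype_le P _).trans ?_
    have hk : ∀ k, P {ω | εd < |d k ω - Sling.correction G hc k|} ≤ ENNReal.ofReal δd := fun k => by
      rw [(hd k).measure_eq (p := fun x => εd < |x - Sling.correction G hc k|)
        (isOpen_lt continuous_const (by fun_prop)).measurableSet]
      exact Sling.estimateCorrection_toMeasure_le G hc hεd hδd k
    refine (Finset.sum_le_sum fun k _ => hk k).trans ?_
    rw [Finset.sum_const, nsmul_eq_mul, Finset.card_univ, ← ENNReal.ofReal_natCast,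
      ← ENNReal.ofReal_mul hcard.le]
    exact ENNReal.ofReal_le_ofReal hδ'
  -- Covering the whole space and using subadditivity avoids proving that `A` is measurable.
  have hcover : Set.univ ⊆ A ∪ ⋃ k, {ω | εd < |d k ω - Sling.correction G hc k|} := fun ω _ => by
    by_cases hω : ∀ k, |d k ω - Sling.correction G hc k| ≤ εd
    · exact Or.inl fun i j => (Sling.abs_singlePairQuery_sub_simRank_le G hc hθ hθ1
        (Sling.simRank_mem_Icc G hc) hω i j).trans hε
    · push Not at hω
      exact Or.inr (Set.mem_iUnion.2 hω)
  have hone : 1 ≤ P A + ENNReal.ofReal δ := by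
    rw [← MeasureTheory.measure_univ (μ := P)]
    exact (MeasureTheory.measure_mono hcover).trans
      ((MeasureTheory.measure_union_le _ _).trans (add_le_add_right hbad _))
  have hδ0 : 0 ≤ δ := le_trans (by positivity) hδ'
  rw [ENNReal.ofReal_sub _ hδ0, ENNReal.ofReal_one]
  exact tsub_le_iff_right.2 hone
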